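/- A signed graph $\Sigma=(V,E,\sigma)$ has a finite vertex set $V$ and a finite edge set $E$. Each edge has exactly two ends, each attached to one vertex or to none, with at least one end attached to a vertex, and it carries a sign $\sigma(e)\in\{1,-1\}$. An edge is a loop if both its ends are attached to the same vertex, a link if they are attached to two distinct vertices, and an outer-edge if only one end is attached to a vertex. An orientation of an edge puts an arrow on each of its two ends; the two arrows have the same direction along the edge if the edge is positive and opposite directions if it is negative. An arc $\vec e$ is an edge with one of its two orientations, and $\vec e^{\,-1}$ is the opposite arc. Let $[v,\vec e\,]$ be the sum of $+1$ for each end of $e$ at $v$ whose arrow points to $v$ and $-1$ for each end of $e$ at $v$ whose arrow points away from $v$. For an abelian group $A$, a flow of $\Sigma$ over $A$ is a function $f$ from arcs to $A$ with $f(\vec e^{\,-1})=-f(\vec e\,)$ and $\sum_{e\in E}[v,\vec e\,]f(\vec e\,)=0$ for every $v\in V$; it is nowhere-zero if all its values are nonzero. A circle is a closed path without repeated vertices or edges (a loop is a circle of length one), and its sign is the product of the signs of its edges. A signed graph is balanced if it has no outer-edges and all its circles are positive. For a nonempty $X\subseteq V$ let $\Sigma[X]$ be the subgraph of loops and links with all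 endpoints in $X$, let $[X,X^c]$ be the set of links between $X$ and $X^c=V\smallsetminus X$, and let $O_X$ be the set of outer-edges with endpoint in $X$. Let $\nu:V\to\{1,-1\}$ with $\nu=1$ off $X$; switching by $\nu$ multiplies $\sigma(e)$ by the value of $\nu$ at the vertex of each attached end of $e$. Let $\delta X^\nu$ be the union of $[X,X^c]$, $O_X$ and the set of edges of $\Sigma[X]$ that are negative after switching by $\nu$. A cut is a nonempty set $U=\delta X^\nu$ of this form such that $\Sigma[X]\smallsetminus U$ is balanced and $(\Sigma[X]\smallsetminus U)\cup e$ is unbalanced for each edge $e$ of $\Sigma[X]$ in $U$. A bond is a minimal cut. A co-loop is an edge $e$ such that $\{e\}$ is a bond. A bridge is an edge whose removal increases the number of connected components by exactly one. $\Sigma\smallsetminus e$ denotes $\Sigma$ with the edge $e$ removed (all vertices are kept). For a positive link $e$, $\Sigma/e$ denotes the signed graph obtained by merging the two endpoints of $e$ into one vertex and removing $e$, with all other ends and signs unchanged. **Proposition.** For every signed graph $\Sigma$ there is a unique polynomial $\varphi(\Sigma;t,x)\in\mathbb{Z}[t,x]$ such that, for every finite abelian group $A$, the number of nowhere-zero flows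 of $\Sigma$ over $A$ equals $\varphi(\Sigma;|\mathrm{Tor}_2 A|,|A|)$, where $\mathrm{Tor}_2 A=\{a\in A:2a=0\}$. (If $E=\varnothing$, then $\varphi=1$.) It satisfies $$\varphi(\Sigma;t,x)=\begin{cases}(x-1)\,\varphi(\Sigma\smallsetminus e;t,x)&\text{if } e \text{ is a positive loop},\\ (t-1)\,\varphi(\Sigma\smallsetminus e;t,x)&\text{if } e \text{ is a negative loop and a co-loop},\\ \varphi(\Sigma/e;t,x)-\varphi(\Sigma\smallsetminus e;t,x)&\text{if } e \text{ is a positive link}.\end{cases}$$ Moreover, $\varphi(\Sigma;t,x)=0$ if and only if $\Sigma$ contains a co-loop that is a bridge or a co-loop that is an outer-edge. -/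

import Mathlib

/-- A signed graph on vertices `V` and edges `E`. Every edge has exactly two ends, indexed by
`Fin 2`; each end is attached to one vertex or to none (`none`), and at least one of the two ends
is attached to a vertex. The sign of an edge is a unit `1` or `-1` of `ℤ`. -/
structure SignedGraph (V E : Type*) where
  ends : E → Fin 2 → Option V
  exists_end : ∀ e, ∃ i, ends e i ≠ none
  sign : E → ℤˣ

namespace SignedGraph

variable {V E : Type*} (G : SignedGraph V E)

/-! ### Kinds of edges -/

/-- `v` is an endpoint of `e`. -/
def IsEndpoint (e : E) (v : V) : Prop := ∃ i, G.ends e i = some v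

/-- `e` is a loop: both ends are attached to a common vertex. -/
def IsLoop (e : E) : Prop := ∃ v, G.ends e 0 = some v ∧ G.ends e 1 = some v

/-- `e` is a link: its ends are attached to two distinct vertices. -/
def IsLink (e : E) : Prop := ∃ u v, u ≠ v ∧ G.ends e 0 = some u ∧ G.ends e 1 = some v

/-- `e` is an outer-edge: only one end is attached to a vertex. -/
def IsOuterEdge (e : E) : Prop := ∃ i, G.ends e i = none

/-- The two ends of `e` are attached to `u` and `v` (in some order, possibly `u = v`). -/
def Joins (e : E) (u v : V) : Prop :=
  (G.ends e 0 = some u ∧ G.ends e 1 = some v) ∨ (G.ends e 0 = some v ∧ G.ends e 1 = some u)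

/-! ### Arcs, chains, flows -/

/-- An arc: an edge with one arrow at each of its two ends. The value `1` at an end means that the
arrow points along the edge towards that end, `-1` that it points away from it. The two arrows have
the same direction along the edge (values of product `-1`) if the edge is positive, and opposite
directions (values of product `1`) if it is negative. -/
structure Arc where
  edge : E
  arrow : Fin 2 → ℤˣ
  arrow_mul : arrow 0 * arrow 1 = -G.sign edge

variable {G} in
/-- The opposite arc. -/
def Arc.inv (a : G.Arc) : G.Arc where
  edge := a.edge
  arrow i := -a.arrow i
  arrow_mul := by rw [neg_mul_neg, a.arrow_mul]

/-- An (arbitrarily selected) orientation of each edge. -/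
def refArc (e : E) : G.Arc where
  edge := e
  arrow := ![1, -G.sign e]
  arrow_mul := by simp

open Classical in
/-- The incidence number `[v, a]`: the sum of the arrows of `a` at the ends attached to `v`. It is
`±1` if `v` is an endpoint of a link or outer-edge, `±2` for a negative loop at `v`, and `0`
otherwise, with sign `+` when the arc points to `v`. -/
noncomputable def incidence (v : V) (a : G.Arc) : ℤ :=
  ∑ i : Fin 2, if G.ends a.edge i = some v then (a.arrow i : ℤ) else 0

/-- A `1`-chain over `A`: a function on arcs that changes sign when the arc is reversed. -/
def Chain (A : Type*) [AddCommGroup A] : Type _ :=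
  {c : G.Arc → A // ∀ a, c a.inv = -c a}

variable {G} in
/-- The boundary of a `1`-chain at a vertex. -/
noncomputable def boundary {A : Type*} [AddCommGroup A] (c : G.Chain A) (v : V) : A :=
  ∑ᶠ e : E, G.incidence v (G.refArc e) • c.1 (G.refArc e)

/-- Each edge has exactly two orientations, opposite to each other. -/
theorem eq_refArc_or (a : G.Arc) : a = G.refArc a.edge ∨ a = (G.refArc a.edge).inv := by
  obtain ⟨e, w, h⟩ := a
  have h1 : w 1 = -G.sign e * w 0 := by
    rw [← h, mul_comm (w 0), mul_assoc, Int.units_mul_self, mul_one]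
  rcases Int.units_eq_one_or (w 0) with h0 | h0
  · left
    simp only [refArc, Arc.mk.injEq, true_and]
    funext i
    fin_cases i <;> simp [h0, h1]
  · right
    simp only [refArc, Arc.inv, Arc.mk.injEq, true_and]
    funext i
    fin_cases i <;> simp [h0, h1]

theorem incidence_inv (v : V) (a : G.Arc) : G.incidence v a.inv = -G.incidence v a := by
  classical
  simp only [incidence, Arc.inv, ← Finset.sum_neg_distrib]
  refine Finset.sum_congr rfl fun i _ => ?_
  by_cases h : G.ends a.edge i = some v <;> simp [h]

/-- The terms of the boundary do not depend on the orientation selected for each edge. -/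
theorem incidence_smul_eq {A : Type*} [AddCommGroup A] (c : G.Chain A) (v : V) (a : G.Arc) :
    G.incidence v a • c.1 a =
      G.incidence v (G.refArc a.edge) • c.1 (G.refArc a.edge) := by
  rcases G.eq_refArc_or a with h | h
  · rw [← h]
  · conv_lhs => rw [h]
    rw [incidence_inv, c.2, neg_smul_neg]

/-- The nowhere-zero flows of `G` over `A`: the chains with zero boundary all of whose values are
nonzero. -/
def nowhereZeroFlows (A : Type*) [AddCommGroup A] : Set (G.Chain A) :=
  {c | (∀ v, boundary c v = 0) ∧ ∀ a, c.1 a ≠ 0}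

/-! ### The flow polynomial -/

/-- The polynomial `p(t, x)`, with `t = X 0` and `x = X 1`, counts the nowhere-zero flows of `G`
over each finite abelian group `A`, at `t = |Tor₂ A|` and `x = |A|`. -/
def IsFlowPolynomial (p : MvPolynomial (Fin 2) ℤ) : Prop :=
  ∀ (A : Type) [AddCommGroup A] [Finite A],
    (Nat.card (G.nowhereZeroFlows A) : ℤ) =
      MvPolynomial.eval ![(Nat.card {a : A // 2 • a = 0} : ℤ), (Nat.card A : ℤ)] p

/-- The flow polynomial `φ(G; t, x)`: the polynomial that counts nowhere-zero flows. -/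
noncomputable def flowPolynomial : MvPolynomial (Fin 2) ℤ :=
  Classical.epsilon G.IsFlowPolynomial

/-! ### Deletion and contraction -/

/-- The graph obtained from `G` by deleting the edge `e` (and no vertex). -/
def delete (e : E) : SignedGraph V {f : E // f ≠ e} where
  ends f := G.ends f
  exists_end f := G.exists_end f
  sign f := G.sign f

/-- The vertices of the contraction: the endpoints of `e` are merged. -/
abbrev ContractVertex (e : E) : Type _ :=
  Quot fun u v : V => G.IsEndpoint e u ∧ G.IsEndpoint e v

/-- The graph obtained from `G` by contracting the positive link `e`: its endpoints are merged into
one vertex, `e` is removed, and the other edges keep their ends and signs. -/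
def contract (e : E) : SignedGraph (G.ContractVertex e) {f : E // f ≠ e} where
  ends f i := (G.ends f i).map (Quot.mk _)
  exists_end f := by
    obtain ⟨i, hi⟩ := G.exists_end f
    exact ⟨i, by simpa using hi⟩
  sign f := G.sign f

/-! ### Components and bridges -/

/-- The number of connected components (an isolated vertex, or a vertex with outer-edges and loops
only, is a component). -/
noncomputable def numComponents : ℕ :=
  Nat.card (Quot fun u v : V => ∃ e, G.Joins e u v)

/-- `e` is a bridge: its removal increases the number of connected components by exactly one. -/
def IsBridge (e : E) : Prop := (G.delete e).numComponents = G.numComponents + 1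

/-! ### Circles and balance -/

/-- A circle of length `n + 1`: distinct vertices `v₀, …, vₙ` and distinct edges `e₀, …, eₙ`, where
`eᵢ` joins `vᵢ` and `vᵢ₊₁`, indices modulo `n + 1`. A loop is a circle of length `1`. -/
structure Circle (n : ℕ) where
  vertex : Fin (n + 1) → V
  edge : Fin (n + 1) → E
  vertex_injective : Function.Injective vertex
  edge_injective : Function.Injective edge
  joins : ∀ i, G.Joins (edge i) (vertex i) (vertex (i + 1))

variable {G} in
/-- The sign of a circle is the product of its edge signs. -/
def Circle.sign {n : ℕ} (C : G.Circle n) : ℤˣ := ∏ i, G.sign (C.edge i)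

/-- The subgraph with edge set `S` is balanced: it has no outer-edges and all its circles are
positive. -/
def IsBalancedOn (S : Set E) : Prop :=
  (∀ e ∈ S, ¬ G.IsOuterEdge e) ∧
    ∀ (n : ℕ) (C : G.Circle n), (∀ i, C.edge i ∈ S) → C.sign = 1

/-! ### Switching, cuts, bonds, co-loops -/

/-- Switching by `ν : V → {1, -1}`: the sign of an edge is multiplied by the values of `ν` at the
vertices to which its ends are attached. -/
def switch (ν : V → ℤˣ) : SignedGraph V E where
  ends := G.ends
  exists_end := G.exists_end
  sign e := G.sign e * ∏ i : Fin 2, (G.ends e i).elim 1 ν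

/-- The edges of the subgraph `G[X]`: loops and links with all endpoints in `X`. -/
def inner (X : Set V) : Set E := {e | ∃ u ∈ X, ∃ v ∈ X, G.Joins e u v}

/-- The set `[X, Xᶜ]` of links between `X` and its complement. -/
def between (X : Set V) : Set E := {e | ∃ u ∈ X, ∃ v ∈ Xᶜ, G.Joins e u v}

/-- The set of outer-edges with endpoint in `X`. -/
def outer (X : Set V) : Set E := {e | G.IsOuterEdge e ∧ ∃ v ∈ X, G.IsEndpoint e v}

/-- The edge set `δX^ν`: the edges of `[X, Xᶜ]`, the edges of `G[X]` that are negative after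
switching by `ν`, and the outer-edges with endpoint in `X`. -/
def cutSet (X : Set V) (ν : V → ℤˣ) : Set E :=
  G.between X ∪ {e ∈ G.inner X | (G.switch ν).sign e = -1} ∪ G.outer X

/-- `U` is a cut: a nonempty set of the form `δX^ν`, with `X` nonempty and `ν` a switching on `X`,
such that `G[X] ∖ U` is balanced, after switching by `ν` the edges of `G[X]` in `U` are negative and
those outside `U` are positive, and `(G[X] ∖ U) ∪ e` is unbalanced for each edge `e` of `G[X]`
in `U`. -/
def IsCut (U : Set E) : Prop :=
  U.Nonempty ∧ ∃ (X : Set V) (ν : V → ℤˣ), X.Nonempty ∧ (∀ v ∉ X, ν v = 1) ∧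
    U = G.cutSet X ν ∧
    G.IsBalancedOn (G.inner X \ U) ∧
    (∀ e ∈ G.inner X ∩ U, (G.switch ν).sign e = -1) ∧
    (∀ e ∈ G.inner X \ U, (G.switch ν).sign e = 1) ∧
    ∀ e ∈ G.inner X ∩ U, ¬ G.IsBalancedOn (insert e (G.inner X \ U))

/-- A bond is a minimal cut. -/
def IsBond (U : Set E) : Prop := Minimal G.IsCut U

/-- A co-loop is an edge that forms a bond by itself. -/
def IsCoLoop (e : E) : Prop := G.IsBond {e}

end SignedGraph

/-! After an orientation is fixed for every edge, a flow is a linear relation between the integer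
incidence columns of the edges, and each column has absolute sum at most 2. Such relations are
counted by elimination (`exists_countsRelations`): an entry `±1` solves for one value, a column with
single entry `±2` leaves a coset of Tor₂, a zero column leaves a free value. Each case is a
deletion-contraction rule (`card_nzRelations_add`), so the count is a polynomial in `t` and `x`. It
is unique because the points `(|Tor₂ A|, |A|)` are Zariski dense (`eq_of_eval_groupPoint_eq`). The
rules for positive loops, positive links and negative co-loops apply the same counting lemma to the
graph.

For the vanishing, integer potentials on vertices are paired with flows. A flow annihilates every
coboundary, so a coboundary equal to `±1` at `e` and 0 elsewhere kills the value at `e`. Conversely,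
the cokernel of the coboundary map carries a universal flow, and a finite quotient of it keeps all
edge values nonzero unless some edge vector is a coboundary
(`exists_coboundary_of_flowPolynomial_eq_zero`). Cut sets give the potentials in one direction
(`exists_coboundary_of_isCoLoop`); in the other, the top level set of `|p|` gives the cut
(`isCoLoop_of_coboundary`). -/

/-! ### Relations between integer columns -/

section ColumnSystem

variable {V V' E A : Type*} [AddCommGroup A]

/-- The linear combination, with coefficients `f`, of the integer columns `c e`, read at `v`. -/
noncomputable def colSum (c : E → V → ℤ) (f : E → A) (v : V) : A := ∑ᶠ e, c e v • f e

variable (A) in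
/-- The relations with all coefficients nonzero between the columns `c e`. -/
def nzRelations (c : E → V → ℤ) : Set (E → A) := {f | (∀ v, colSum c f v = 0) ∧ ∀ e, f e ≠ 0}

theorem finsum_eq_add_finsum_ne [Finite E] (g : E → A) (e : E) :
    ∑ᶠ i, g i = g e + ∑ᶠ i : {i // i ≠ e}, g i := by
  classical
  cases nonempty_fintype E
  rw [finsum_eq_sum_of_fintype, finsum_eq_sum_of_fintype,
    Fintype.sum_eq_add_sum_subtype_ne _ e]

theorem colSum_eq_add [Finite E] (c : E → V → ℤ) (e : E) (f : E → A) (v : V) :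
    colSum c f v = c e v • f e + colSum (fun i : {i // i ≠ e} => c i) (fun i => f i) v :=
  finsum_eq_add_finsum_ne _ e

theorem colSum_zero (c : E → V → ℤ) (f : E → A) (v : V) (h : ∀ e, c e v = 0) :
    colSum c f v = 0 := by
  simp [colSum, h]

theorem colSum_sub_mul [Finite E] (c : E → V → ℤ) (k : V → ℤ) (v : V) (f : E → A) (w : V) :
    colSum (fun e w => c e w - k w * c e v) f w = colSum c f w - k w • colSum c f v := by
  cases nonempty_fintype E
  simp only [colSum, finsum_eq_sum_of_fintype, Finset.smul_sum, ← Finset.sum_sub_distrib,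
    sub_smul, mul_smul]

/-- If the relations with arbitrary coefficient at `e` are given by a coset of `T` for the
coefficient at `e` and by the relations between the columns `c'` for the others, then the relations
are counted by a deletion-contraction rule. -/
theorem card_nzRelations_add [Finite E] [Finite A] (c : E → V → ℤ) (e : E)
    (c' : {i // i ≠ e} → V' → ℤ) (T : Set A) (s : ({i // i ≠ e} → A) → A)
    (h : ∀ (a : A) (g : {i // i ≠ e} → A),
      (∀ v, c e v • a + colSum (fun i : {i // i ≠ e} => c i) g v = 0) ↔
        a - s g ∈ T ∧ ∀ v, colSum c' g v = 0) :
    Nat.card (nzRelations A c) + Nat.card (nzRelations A fun i : {i // i ≠ e} => c i) =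
      Nat.card T * Nat.card (nzRelations A c') := by
  classical
  -- The value at `e` is unconstrained in `S`: value zero gives the relations without `e`, a nonzero
  -- value those counted for `c`. Translation by `s` turns `S` into a product.
  let S : Set (A × ({i // i ≠ e} → A)) :=
    {p | (∀ v, c e v • p.1 + colSum (fun i : {i // i ≠ e} => c i) p.2 v = 0) ∧ ∀ i, p.2 i ≠ 0}
  have h0 : Nat.card (nzRelations A fun i : {i // i ≠ e} => c i) =
      Nat.card {p : S // p.1.1 = 0} := by
    refine Nat.card_congr ⟨fun g => ⟨⟨(0, g.1), ?_⟩, rfl⟩, fun p => ⟨p.1.1.2, ?_⟩, ?_, ?_⟩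
    · exact ⟨fun v => by simpa using g.2.1 v, g.2.2⟩
    · exact ⟨fun v => by simpa [p.2] using p.1.2.1 v, p.1.2.2⟩
    · intro g
      rfl
    · rintro ⟨⟨⟨a, g⟩, hp⟩, rfl : a = 0⟩
      rfl
  have h1 : Nat.card (nzRelations A c) = Nat.card {p : S // ¬ p.1.1 = 0} := by
    let F := Equiv.funSplitAt e A
    refine Nat.card_congr ⟨fun f => ⟨⟨F f.1, ?_⟩, ?_⟩, fun p => ⟨F.symm p.1.1, ?_⟩, ?_, ?_⟩
    · exact ⟨fun v => (colSum_eq_add c e f.1 v).symm.trans (f.2.1 v), fun i => f.2.2 i⟩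
    · exact f.2.2 e
    · have hF : F (F.symm p.1.1) = p.1.1 := F.apply_symm_apply _
      have hF1 : F.symm p.1.1 e = p.1.1.1 := congrArg Prod.fst hF
      have hF2 : (fun i : {i // i ≠ e} => F.symm p.1.1 i) = p.1.1.2 := congrArg Prod.snd hF
      refine ⟨fun v => ?_, fun i => ?_⟩
      · rw [colSum_eq_add c e, hF1, hF2]
        exact p.1.2.1 v
      · by_cases hi : i = e
        · rw [hi, hF1]
          exact p.2
        · have := congrFun hF2 ⟨i, hi⟩
          simp only at this
          rw [this]
          exact p.1.2.2 ⟨i, hi⟩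
    · intro f
      exact Subtype.ext (F.symm_apply_apply _)
    · intro p
      exact Subtype.ext (Subtype.ext (F.apply_symm_apply _))
  have h2 : Nat.card S = Nat.card T * Nat.card (nzRelations A c') := by
    rw [← Nat.card_prod]
    refine Nat.card_congr ⟨fun p => (⟨p.1.1 - s p.1.2, ((h _ _).1 p.2.1).1⟩,
      ⟨p.1.2, ((h _ _).1 p.2.1).2, p.2.2⟩), fun q => ⟨(q.1.1 + s q.2.1, q.2.1), ?_⟩, ?_, ?_⟩
    · refine ⟨(h _ _).2 ⟨?_, q.2.2.1⟩, q.2.2.2⟩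
      simp
    · intro p
      simp
    · intro q
      simp
  rw [h0, h1, add_comm, ← Nat.card_sum, ← h2]
  exact Nat.card_congr (Equiv.sumCompl _)

end ColumnSystem

/-! ### Polynomial counts: existence and uniqueness -/

section Counting

open MvPolynomial

variable {V E : Type*}

/-- The values of the two variables at a finite abelian group. -/
noncomputable def groupPoint (A : Type) [AddCommGroup A] : Fin 2 → ℤ :=
  ![(Nat.card {a : A // 2 • a = 0} : ℤ), (Nat.card A : ℤ)]

/-- `p` counts the relations with nonzero coefficients between the columns `c e`. -/
def CountsRelations (c : E → V → ℤ) (p : MvPolynomial (Fin 2) ℤ) : Prop :=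
  ∀ (A : Type) [AddCommGroup A] [Finite A],
    (Nat.card (nzRelations A c) : ℤ) = eval (groupPoint A) p

theorem countsRelations_of_isEmpty [IsEmpty E] (c : E → V → ℤ) : CountsRelations c 1 := by
  intro A _ _
  have : nzRelations A c = Set.univ := by
    ext f
    simp [nzRelations, colSum, finsum_of_isEmpty]
  rw [this, map_one]
  simp

/-- A column of absolute sum at most two with an entry of absolute value two has no other entry. -/
theorem entry_eq_zero_of_sum_le_two [Fintype V] (c : V → ℤ) (hc : ∑ v, |c v| ≤ 2)
    (v : V) (hv : 2 ≤ |c v|) (w : V) (hw : w ≠ v) : c w = 0 := by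
  classical
  have h := Finset.add_le_sum (f := fun v => |c v|) (fun i _ => abs_nonneg _)
    (Finset.mem_univ v) (Finset.mem_univ w) hw.symm
  have h0 := abs_nonneg (c w)
  exact abs_eq_zero.1 (by lia)

/-- Subtracting a multiple of a column with entry `±1` so that the entry becomes zero. -/
theorem sum_abs_pivot_le [Fintype V] (c d : V → ℤ) (v : V) (hd : |d v| = 1) (hd2 : ∑ w, |d w| ≤ 2) :
    ∑ w, |c w - d w * d v * c v| ≤ ∑ w, |c w| := by
  classical
  have hdv : d v * d v = 1 := by rw [← abs_mul_abs_self, hd, mul_one]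
  rw [← Finset.add_sum_erase _ _ (Finset.mem_univ v),
    ← Finset.add_sum_erase _ (fun w => |c w|) (Finset.mem_univ v)]
  rw [← Finset.add_sum_erase _ _ (Finset.mem_univ v), hd] at hd2
  have h1 : c v - d v * d v * c v = 0 := by linear_combination (-c v) * hdv
  have h2 : ∀ w ∈ Finset.univ.erase v, |c w - d w * d v * c v| ≤ |c w| + |c v| * |d w| := by
    intro w _
    refine (abs_sub _ _).trans ?_
    rw [abs_mul, abs_mul, hd, mul_one, mul_comm]
  have h3 := Finset.sum_le_sum h2
  rw [Finset.sum_add_distrib, ← Finset.mul_sum] at h3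
  have h4 := mul_le_mul_of_nonneg_left (by linarith : ∑ w ∈ Finset.univ.erase v, |d w| ≤ 1)
    (abs_nonneg (c v))
  rw [h1, abs_zero]
  linarith

/-- Induction on the number of columns. The bound 2 survives pivoting on an entry `±1`; once no such
entry exists, every column is zero or has a single entry `±2`, so no other case occurs. -/
theorem exists_countsRelations [Finite V] [Finite E] (c : E → V → ℤ)
    (hc : ∀ [Fintype V] e, ∑ v, |c e v| ≤ 2) : ∃ p, CountsRelations c p := by
  classical
  cases nonempty_fintype V
  induction hn : Nat.card E generalizing E with
  | zero =>
    have : IsEmpty E := by simpa using (Nat.card_eq_zero.1 hn).resolve_right (by simpa)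
    exact ⟨1, countsRelations_of_isEmpty c⟩
  | succ n ih =>
    have hcard : ∀ e : E, Nat.card {i // i ≠ e} = n := by
      intro e
      cases nonempty_fintype E
      rw [Nat.card_eq_fintype_card] at hn ⊢
      simp [Fintype.card_subtype_compl, hn]
    by_cases h1 : ∃ e v, |c e v| = 1
    · obtain ⟨e, v, hv⟩ := h1
      obtain ⟨p, hp⟩ := ih (fun i : {i // i ≠ e} => c i) (fun i => by convert hc i) (hcard e)
      have hb : ∀ i, ∑ w, |c i w - c e w * c e v * c i v| ≤ 2 := fun i =>
        (sum_abs_pivot_le (c i) (c e) v hv (by convert hc e)).trans (by convert hc i)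
      obtain ⟨q, hq⟩ := ih (fun (i : {i // i ≠ e}) w => c i w - c e w * c e v * c i v)
        (fun i => by convert hb i) (hcard e)
      refine ⟨q - p, fun A _ _ => ?_⟩
      have hev : c e v * c e v = 1 := by rw [← abs_mul_abs_self, hv, mul_one]
      have := card_nzRelations_add (A := A) c e
        (fun (i : {i // i ≠ e}) w => c i w - c e w * c e v * c i v) {0}
        -- Row `v` solved for the value at `e`; the entry `c e v` is its own inverse.
        (fun g => -(c e v • colSum (fun i : {i // i ≠ e} => c i) g v)) (by
          intro a g
          simp only [colSum_sub_mul (fun i : {i // i ≠ e} => c i) (fun w => c e w * c e v),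
            Set.mem_singleton_iff, sub_neg_eq_add]
          constructor
          · intro h
            have ha : a + c e v • colSum (fun i : {i // i ≠ e} => c i) g v = 0 := by
              have := congrArg (c e v • ·) (h v)
              simpa [smul_smul, hev] using this
            refine ⟨ha, fun w => ?_⟩
            rw [mul_smul, eq_neg_of_add_eq_zero_right ha, smul_neg, sub_neg_eq_add, add_comm]
            exact h w
          · rintro ⟨ha, h⟩ w
            rw [sub_eq_zero.1 (h w), mul_smul, ← smul_add, ha, smul_zero])
      rw [map_sub, ← hp A, ← hq A, eq_sub_iff_add_eq]
      exact_mod_cast this.trans (by simp)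
    -- From here every entry of every column is 0 or `±2`, so all rows can be halved.
    · push Not at h1
      have hE : Nonempty E := (Nat.card_pos_iff.1 (by lia)).1
      obtain ⟨e⟩ := hE
      obtain ⟨p, hp⟩ := ih (fun i : {i // i ≠ e} => c i) (fun i => by convert hc i) (hcard e)
      by_cases h2 : ∃ v, c e v ≠ 0
      · obtain ⟨v, hv⟩ := h2
        have htwo : ∀ i, c i v = 2 * (c i v / 2) ∧ |c i v| ≤ 2 := by
          intro i
          have h := (Finset.single_le_sum (f := fun v => |c i v|) (fun w _ => abs_nonneg _)
            (Finset.mem_univ v)).trans (hc i)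
          have h' := h1 i v
          grind
        have hz := entry_eq_zero_of_sum_le_two (c e) (hc e) v (by
          have := htwo e
          grind)
        have hunit : (c e v / 2) * (c e v / 2) = 1 := by
          have h3 := htwo e
          have : c e v / 2 = 1 ∨ c e v / 2 = -1 := by grind
          rcases this with h | h <;> simp [h]
        obtain ⟨q, hq⟩ := ih (fun (i : {i // i ≠ e}) w => if w = v then 0 else c i w)
          (fun i => by
            refine le_trans (Finset.sum_le_sum fun w _ => ?_) (hc i)
            split_ifs <;> simp) (hcard e)
        refine ⟨X 0 * q - p, fun A _ _ => ?_⟩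
        have := card_nzRelations_add (A := A) c e
          (fun (i : {i // i ≠ e}) w => if w = v then 0 else c i w) {a | 2 • a = 0}
          -- Row `v` is twice its halved row, so it fixes the value at `e` only up to 2-torsion. It
          -- puts no condition on the other values and is replaced by zero in `q`.
          (fun g => -((c e v / 2) • colSum (fun (i : {i // i ≠ e}) (w : V) => c i w / 2) g v)) (by
            intro a g
            have hv2 : colSum (fun i : {i // i ≠ e} => c i) g v =
                2 • colSum (fun (i : {i // i ≠ e}) (w : V) => c i w / 2) g v := by
              cases nonempty_fintype E
              simp only [colSum, finsum_eq_sum_of_fintype, Finset.smul_sum]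
              refine Finset.sum_congr rfl fun i _ => ?_
              conv_lhs => rw [(htwo i).1, mul_smul, ofNat_zsmul]
            set D := colSum (fun (i : {i // i ≠ e}) (w : V) => c i w / 2) g v
            have hT : 2 • (a - -((c e v / 2) • D)) =
                (c e v / 2) • (c e v • a + colSum (fun i : {i // i ≠ e} => c i) g v) := by
              rw [hv2, smul_add, smul_smul, sub_neg_eq_add, smul_add]
              congr 1
              · conv_rhs => rw [(htwo e).1]
                rw [Int.mul_ediv_cancel_left _ two_ne_zero, mul_left_comm, hunit, mul_one, ofNat_zsmul]
              · rw [smul_comm]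
            have hw : ∀ w, w ≠ v →
                colSum (fun (i : {i // i ≠ e}) w => if w = v then 0 else c i w) g w =
                  c e w • a + colSum (fun i : {i // i ≠ e} => c i) g w := by
              intro w hw
              rw [hz w hw, zero_smul, zero_add]
              simp only [colSum, if_neg hw]
            rw [Set.mem_ofPred_eq, hT]
            constructor
            · intro h
              refine ⟨by rw [h v, smul_zero], fun w => ?_⟩
              by_cases h' : w = v
              · exact colSum_zero _ _ _ fun i => if_pos h'
              · rw [hw w h', h w]
            · rintro ⟨ha, h⟩ w
              by_cases h' : w = v
              · have := congrArg ((c e v / 2) • ·) ha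
                simp only [smul_smul, hunit, one_smul, smul_zero] at this
                rw [h', this]
              · rw [← hw w h', h w])
        rw [map_sub, map_mul, ← hp A, ← hq A, eq_sub_iff_add_eq, eval_X]
        have := congrArg (Nat.cast : ℕ → ℤ) this
        push_cast at this
        exact this
      · push Not at h2
        refine ⟨X 1 * p - p, fun A _ _ => ?_⟩
        have := card_nzRelations_add (A := A) c e (fun i : {i // i ≠ e} => c i) Set.univ
          (fun _ => 0) (by simp [h2])
        rw [Nat.card_congr (Equiv.Set.univ A)] at this
        rw [map_sub, map_mul, ← hp A, eq_sub_iff_add_eq, eval_X]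
        have := congrArg (Nat.cast : ℕ → ℤ) this
        push_cast at this
        exact this

/-! ### Density of the points of finite abelian groups -/

/-- Multiplication by 2 is zero on the first factor and invertible on the second. These groups
realize the points `(2 ^ k, 2 ^ k * m)` with `m` odd. -/
theorem card_twoTorsion_pi (k m : ℕ) (hm : Odd m) :
    Nat.card {a : (Fin k → ZMod 2) × ZMod m // 2 • a = 0} = 2 ^ k := by
  have h2 : ∀ b : ZMod m, 2 • b = 0 → b = 0 := by
    intro b hb
    have hu : IsUnit ((2 : ℕ) : ZMod m) :=
      (ZMod.isUnit_iff_coprime 2 m).2 (Nat.coprime_two_left.2 hm)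
    rw [nsmul_eq_mul] at hb
    exact (hu.mul_right_eq_zero).1 hb
  have h0 : ∀ a : Fin k → ZMod 2, 2 • a = 0 := by
    intro a
    ext i
    simp [nsmul_eq_mul, show (2 : ZMod 2) = 0 from rfl]
  rw [Nat.card_congr (β := Fin k → ZMod 2)
    ⟨fun a => a.1.1, fun a => ⟨(a, 0), by simp [Prod.ext_iff, h0]⟩, fun a => ?_, fun a => rfl⟩]
  · simp
  · exact Subtype.ext (Prod.ext rfl (h2 _ (congrArg Prod.snd a.2)).symm)

/-- The points of finite abelian groups are Zariski dense. -/
theorem eq_of_eval_groupPoint_eq (p q : MvPolynomial (Fin 2) ℤ)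
    (h : ∀ (A : Type) [AddCommGroup A] [Finite A],
      eval (groupPoint A) p = eval (groupPoint A) q) : p = q := by
  -- For fixed `k` the two sides are one-variable polynomials in `x` that agree at the infinitely
  -- many `2 ^ k * (2 * m + 1)`.
  have key : ∀ (k : ℕ) (x : ℤ), eval ![(2 : ℤ) ^ k, x] p = eval ![(2 : ℤ) ^ k, x] q := by
    intro k x
    let F : MvPolynomial (Fin 2) ℤ → Polynomial ℤ :=
      aeval ![Polynomial.C ((2 : ℤ) ^ k), Polynomial.X]
    have hF : ∀ r y, (F r).eval y = eval ![(2 : ℤ) ^ k, y] r := by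
      intro r y
      rw [← Polynomial.coe_evalRingHom]
      simp only [F, aeval_def, eval₂_eq_eval_map]
      induction r using MvPolynomial.induction_on with
      | C a => simp
      | add p q hp hq => simp_all
      | mul_X p i hp =>
        rw [map_mul, map_mul, map_mul, hp, map_mul]
        congr 1
        fin_cases i <;> simp
    have hpq : F p = F q := by
      refine Polynomial.eq_of_infinite_eval_eq _ _ (Set.infinite_of_injective_forall_mem
        (f := fun m : ℕ => (2 : ℤ) ^ k * (2 * m + 1)) (fun a b hab => ?_) fun m => ?_)
      · simpa using hab
      · have hm : NeZero (2 * m + 1) := ⟨by lia⟩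
        have := h ((Fin k → ZMod 2) × ZMod (2 * m + 1))
        rw [groupPoint, card_twoTorsion_pi k _ (odd_two_mul_add_one m)] at this
        simp only [Set.mem_ofPred_eq, hF]
        simpa using this
    rw [← hF, ← hF, hpq]
  refine funext_set ![Set.range fun k : ℕ => (2 : ℤ) ^ k, Set.univ] (fun i => ?_) fun x hx => ?_
  · fin_cases i
    · exact Set.infinite_range_of_injective (Int.pow_right_injective (by simp))
    · exact Set.infinite_univ
  · obtain ⟨k, hk⟩ := hx 0 trivial
    have : x = ![(2 : ℤ) ^ k, x 1] := by
      ext i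
      fin_cases i
      · exact hk.symm
      · rfl
    rw [this]
    exact key k (x 1)

end Counting

/-! ### The flow polynomial, deletion and contraction -/

namespace SignedGraph

variable {V E : Type*} (G : SignedGraph V E)

/-- The column of incidence numbers of the selected orientation of `e`. -/
noncomputable def column (e : E) (v : V) : ℤ := G.incidence v (G.refArc e)

open Classical in
/-- `1` if an end attached as prescribed by `o` is attached to `v`, and `0` otherwise. -/
noncomputable def attached (o : Option V) (v : V) : ℤ := if o = some v then 1 else 0

theorem attached_of_eq {o : Option V} {v : V} (h : o = some v) : attached o v = 1 := if_pos h

theorem attached_of_ne {o : Option V} {v : V} (h : o ≠ some v) : attached o v = 0 := if_neg h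

theorem attached_congr {V' : Type*} {o : Option V} {v : V} {o' : Option V'} {v' : V'}
    (h : o = some v ↔ o' = some v') : attached o v = attached o' v' := by
  classical
  simp only [attached, h]

theorem sum_mul_attached [Fintype V] (p : V → ℤ) (o : Option V) :
    ∑ v, p v * attached o v = o.elim 0 p := by
  classical
  cases o <;> simp [attached]

theorem column_eq (e : E) (v : V) : G.column e v =
    attached (G.ends e 0) v - G.sign e * attached (G.ends e 1) v := by
  simp only [column, incidence, refArc, Fin.sum_univ_two, sub_eq_add_neg, attached]
  congr 1
  by_cases h : G.ends e 1 = some v <;> simp [h]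

/-- A chain is determined by its values on the selected orientations, which are arbitrary. -/
noncomputable def chainEquiv (A : Type*) [AddCommGroup A] : G.Chain A ≃ (E → A) where
  toFun c e := c.1 (G.refArc e)
  -- `refArc` has arrow 1 at end 0, so the arrow there tells the two orientations apart.
  invFun f := ⟨fun a => (a.arrow 0 : ℤ) • f a.edge, fun a => by simp [Arc.inv]⟩
  left_inv c := by
    refine Subtype.ext (funext fun a => ?_)
    rcases G.eq_refArc_or a with h | h
    · conv_rhs => rw [h]
      rw [h]
      simp [refArc]
    · conv_rhs => rw [h]
      rw [h, c.2]
      simp [refArc, Arc.inv]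
  right_inv f := by
    ext e
    simp [refArc]

theorem card_nowhereZeroFlows (A : Type*) [AddCommGroup A] :
    Nat.card (G.nowhereZeroFlows A) = Nat.card (nzRelations A G.column) := by
  refine Nat.card_congr ((G.chainEquiv A).subtypeEquiv fun c => and_congr Iff.rfl
    ⟨fun h e => h _, fun h a => ?_⟩)
  rcases G.eq_refArc_or a with ha | ha
  · rw [ha]
    exact h _
  · rw [ha, c.2]
    exact neg_ne_zero.2 (h _)

theorem isFlowPolynomial_iff (p : MvPolynomial (Fin 2) ℤ) :
    G.IsFlowPolynomial p ↔ CountsRelations G.column p := by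
  unfold IsFlowPolynomial CountsRelations
  refine forall_congr' fun A => forall_congr' fun _ => forall_congr' fun _ => ?_
  rw [card_nowhereZeroFlows]
  rfl

theorem IsFlowPolynomial.eq {p q : MvPolynomial (Fin 2) ℤ} (hp : G.IsFlowPolynomial p)
    (hq : G.IsFlowPolynomial q) : p = q :=
  eq_of_eval_groupPoint_eq p q fun A _ _ => (hp A).symm.trans (hq A)

theorem sum_abs_column_le [Fintype V] (e : E) : ∑ v, |G.column e v| ≤ 2 := by
  have h0 : ∀ (o : Option V) v, 0 ≤ attached o v := by
    intro o v
    unfold attached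
    split_ifs <;> simp
  have h : ∀ v, |G.column e v| ≤ attached (G.ends e 0) v + attached (G.ends e 1) v := by
    intro v
    rw [column_eq]
    refine (abs_sub _ _).trans ?_
    rw [abs_mul, Int.isUnit_iff_abs_eq.1 (G.sign e).isUnit, one_mul, abs_of_nonneg (h0 _ _),
      abs_of_nonneg (h0 _ _)]
  have h1 : ∀ o : Option V, ∑ v, attached o v ≤ 1 := by
    intro o
    have := sum_mul_attached (fun _ => 1) o
    simp only [one_mul] at this
    rw [this]
    cases o <;> simp
  refine (Finset.sum_le_sum fun v _ => h v).trans ?_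
  rw [Finset.sum_add_distrib]
  linarith [h1 (G.ends e 0), h1 (G.ends e 1)]

/-- The map that sends every endpoint of `e` to `none` and fixes the other vertices descends to the
quotient and separates its classes. -/
theorem contract_mk_eq_iff (e : E) (u v : V) :
    (Quot.mk _ u : G.ContractVertex e) = Quot.mk _ v ↔
      u = v ∨ G.IsEndpoint e u ∧ G.IsEndpoint e v := by
  classical
  constructor
  · intro h
    have := congrArg (Quot.lift (fun v => if G.IsEndpoint e v then none else some v)
      (fun a b hab => by rw [if_pos hab.1, if_pos hab.2])) h
    simp only at this
    by_cases hu : G.IsEndpoint e u <;> by_cases hv : G.IsEndpoint e v <;> simp_all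
  · rintro (h | h)
    · rw [h]
    · exact Quot.sound h

variable [Finite V] [Finite E]

theorem exists_isFlowPolynomial : ∃ p, G.IsFlowPolynomial p := by
  obtain ⟨p, hp⟩ := exists_countsRelations G.column fun e => G.sum_abs_column_le e
  exact ⟨p, (G.isFlowPolynomial_iff p).2 hp⟩

theorem isFlowPolynomial_flowPolynomial : G.IsFlowPolynomial G.flowPolynomial :=
  Classical.epsilon_spec G.exists_isFlowPolynomial

theorem card_nzRelations_column (A : Type) [AddCommGroup A] [Finite A] :
    (Nat.card (nzRelations A G.column) : ℤ) =
      MvPolynomial.eval (groupPoint A) G.flowPolynomial :=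
  (G.isFlowPolynomial_iff _).1 G.isFlowPolynomial_flowPolynomial A

/-- A deletion-contraction rule for the relations between columns, in terms of polynomials. -/
theorem flowPolynomial_add_delete (e : E) {V' : Type*} [Finite V']
    (H : SignedGraph V' {f // f ≠ e}) (k : MvPolynomial (Fin 2) ℤ)
    (h : ∀ (A : Type) [AddCommGroup A] [Finite A], ∃ (T : Set A) (s : ({f // f ≠ e} → A) → A),
      (Nat.card T : ℤ) = MvPolynomial.eval (groupPoint A) k ∧
      ∀ (a : A) (g : {f // f ≠ e} → A),
        (∀ v, G.column e v • a + colSum (G.delete e).column g v = 0) ↔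
          a - s g ∈ T ∧ ∀ v, colSum H.column g v = 0) :
    G.flowPolynomial + (G.delete e).flowPolynomial = k * H.flowPolynomial := by
  refine eq_of_eval_groupPoint_eq _ _ fun A _ _ => ?_
  obtain ⟨T, s, hT, hs⟩ := h A
  have := congrArg (Nat.cast : ℕ → ℤ) (card_nzRelations_add G.column e H.column T s hs)
  rw [map_add, map_mul, ← card_nzRelations_column, ← card_nzRelations_column,
    ← card_nzRelations_column, ← hT]
  push_cast at this
  exact this

theorem flowPolynomial_positive_loop (e : E) (hl : G.IsLoop e) (hs : G.sign e = 1) :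
    G.flowPolynomial = (MvPolynomial.X 1 - 1) * (G.delete e).flowPolynomial := by
  rw [sub_mul, one_mul, eq_sub_iff_add_eq]
  refine G.flowPolynomial_add_delete e (G.delete e) _ fun A _ _ =>
    ⟨Set.univ, fun _ => 0, ?_, fun a g => ?_⟩
  · rw [Nat.card_congr (Equiv.Set.univ A), MvPolynomial.eval_X]
    rfl
  · obtain ⟨u, h0, h1⟩ := hl
    have hc : ∀ v, G.column e v = 0 := fun v => by rw [column_eq, h0, h1, hs]; simp
    simp [hc]

/-- The column of `e` is `+1` at `u` and `-1` at `w`. The equation at `u` determines the value at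
`e`; what remains at `w` is the sum of the two rows, which is the equation at the merged vertex. -/
theorem flowPolynomial_contract (e : E) (hl : G.IsLink e) (hs : G.sign e = 1) :
    G.flowPolynomial = (G.contract e).flowPolynomial - (G.delete e).flowPolynomial := by
  classical
  obtain ⟨u, w, huw, h0, h1⟩ := hl
  have hend : ∀ v, G.IsEndpoint e v ↔ v = u ∨ v = w := by
    intro v
    simp [IsEndpoint, Fin.exists_fin_two, h0, h1, eq_comm]
  have hmk : ∀ o : Option V, ∀ v, v ≠ u → v ≠ w →
      (o.map (Quot.mk _ : V → G.ContractVertex e) = some (Quot.mk _ v) ↔ o = some v) := by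
    intro o v hu hw
    cases o <;> simp [contract_mk_eq_iff, hend, hu, hw]
  have hmku : ∀ o : Option V,
      (o.map (Quot.mk _ : V → G.ContractVertex e) = some (Quot.mk _ u) ↔
        o = some u ∨ o = some w) := by
    intro o
    cases o <;> simp [contract_mk_eq_iff, hend]
  have hcol : ∀ f : {f // f ≠ e}, ∀ v, v ≠ u → v ≠ w →
      (G.contract e).column f (Quot.mk _ v) = (G.delete e).column f v := by
    intro f v hu hw
    rw [column_eq, column_eq]
    exact congrArg₂ (· - _ * ·) (attached_congr (hmk _ v hu hw)) (attached_congr (hmk _ v hu hw))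
  have hcolu : ∀ f : {f // f ≠ e},
      (G.contract e).column f (Quot.mk _ u) =
        (G.delete e).column f u + (G.delete e).column f w := by
    intro f
    have hor : ∀ o : Option V,
        attached (o.map (Quot.mk _ : V → G.ContractVertex e)) (Quot.mk _ u) =
          attached o u + attached o w := by
      intro o
      by_cases hu : o = some u
      · rw [attached_of_eq ((hmku o).2 (Or.inl hu)), attached_of_eq hu,
          attached_of_ne (by simpa [hu] using huw), add_zero]
      · rw [attached_of_ne hu, zero_add]
        exact attached_congr ((hmku o).trans (or_iff_right hu))
    rw [column_eq, column_eq, column_eq]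
    simp only [contract, delete, hor]
    ring
  rw [eq_sub_iff_add_eq, ← one_mul (G.contract e).flowPolynomial]
  refine G.flowPolynomial_add_delete e (G.contract e) _ fun A _ _ =>
    ⟨{0}, fun g => -colSum (G.delete e).column g u, by simp, fun a g => ?_⟩
  have hS : ∀ v, v ≠ u → v ≠ w →
      colSum (G.contract e).column g (Quot.mk _ v) = colSum (G.delete e).column g v := by
    intro v hu hw
    simp only [colSum, hcol _ v hu hw]
  have hSu : colSum (G.contract e).column g (Quot.mk _ u) =
      colSum (G.delete e).column g u + colSum (G.delete e).column g w := by
    cases nonempty_fintype E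
    simp only [colSum, hcolu, finsum_eq_sum_of_fintype, add_smul, Finset.sum_add_distrib]
  have hwu : (Quot.mk _ w : G.ContractVertex e) = Quot.mk _ u :=
    (G.contract_mk_eq_iff e w u).2 (Or.inr ⟨(hend w).2 (Or.inr rfl), (hend u).2 (Or.inl rfl)⟩)
  have hcu : G.column e u = 1 := by simp [column_eq, h0, h1, attached, huw.symm]
  have hcw : G.column e w = -1 := by simp [column_eq, h0, h1, attached, huw, hs]
  have hcv : ∀ v, v ≠ u → v ≠ w → G.column e v = 0 := by
    intro v hu hw
    simp [column_eq, h0, h1, attached, hu.symm, hw.symm]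
  rw [Set.mem_singleton_iff, sub_neg_eq_add]
  constructor
  · intro h
    have hu := h u
    have hw := h w
    rw [hcu, one_smul] at hu
    rw [hcw, neg_smul, one_smul, neg_add_eq_zero] at hw
    refine ⟨hu, fun q => ?_⟩
    obtain ⟨v, rfl⟩ := Quot.exists_rep q
    by_cases hvu : v = u
    · rw [hvu, hSu, ← hw, add_comm, hu]
    by_cases hvw : v = w
    · rw [hvw, hwu, hSu, ← hw, add_comm, hu]
    · have := h v
      rwa [hcv v hvu hvw, zero_smul, zero_add, ← hS v hvu hvw] at this
  · rintro ⟨ha, h⟩ v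
    have hu := h (Quot.mk _ u)
    rw [hSu] at hu
    by_cases hvu : v = u
    · rw [hvu, hcu, one_smul, ha]
    by_cases hvw : v = w
    · rw [hvw, hcw, neg_smul, one_smul, neg_add_eq_zero]
      exact add_right_cancel (b := colSum (G.delete e).column g u)
        (ha.trans (hu.symm.trans (add_comm _ _)))
    · rw [hcv v hvu hvw, zero_smul, zero_add, ← hS v hvu hvw, h]

end SignedGraph

/-! ### Potentials, co-loops and the vanishing criterion -/

namespace SignedGraph

variable {V E : Type*} (G : SignedGraph V E)

/-! ### Components -/

/-- The connected components. -/
abbrev Component : Type _ := Quot fun u v : V => ∃ e, G.Joins e u v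

variable {G} in
theorem Joins.symm {e : E} {u v : V} (h : G.Joins e u v) : G.Joins e v u :=
  Or.symm h

variable {G} in
theorem Joins.eq_or {e : E} {u v u' v' : V} (h : G.Joins e u v) (h' : G.Joins e u' v') :
    (u' = u ∧ v' = v) ∨ (u' = v ∧ v' = u) := by
  unfold Joins at h h'
  grind

variable {G} in
theorem Joins.not_isOuterEdge {e : E} {u v : V} (h : G.Joins e u v) : ¬ G.IsOuterEdge e := by
  rintro ⟨i, hi⟩
  unfold Joins at h
  fin_cases i <;> simp_all

/-- The component of `G` containing a given component of `G ∖ e`. -/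
def componentOfDelete (e : E) : (G.delete e).Component → G.Component :=
  Quot.map id fun _ _ ⟨f, hf⟩ => ⟨f.1, hf⟩

theorem numComponents_delete_eq (e : E)
    (h : ∀ u v, G.Joins e u v → (Quot.mk _ u : (G.delete e).Component) = Quot.mk _ v) :
    (G.delete e).numComponents = G.numComponents := by
  refine Nat.card_congr ⟨G.componentOfDelete e, Quot.lift (Quot.mk _) ?_, ?_, ?_⟩
  · rintro u v ⟨f, hf⟩
    by_cases hfe : f = e
    · exact h u v (hfe ▸ hf)
    · exact Quot.sound ⟨⟨f, hfe⟩, hf⟩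
  · rintro ⟨u⟩
    rfl
  · rintro ⟨u⟩
    rfl

/-- Sending the component of `u` to `none` and every other one to its component in `G` is a
bijection onto `Option G.Component`. The map `g`, which picks the side of `v` in the merged
component, gives injectivity. -/
theorem isBridge_of_joins [Finite V] (e : E) {u v : V} (hJ : G.Joins e u v)
    (h : (Quot.mk _ u : (G.delete e).Component) ≠ Quot.mk _ v) : G.IsBridge e := by
  classical
  let π := G.componentOfDelete e
  let g : G.Component → (G.delete e).Component :=
    Quot.lift (fun w => if (Quot.mk _ w : (G.delete e).Component) = Quot.mk _ u then Quot.mk _ v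
      else Quot.mk _ w) (by
        rintro a b ⟨f, hf⟩
        by_cases hfe : f = e
        · subst hfe
          rcases hJ.eq_or hf with ⟨rfl, rfl⟩ | ⟨rfl, rfl⟩
          · simp [h.symm]
          · simp [h.symm]
        · have : (Quot.mk _ a : (G.delete e).Component) = Quot.mk _ b :=
            Quot.sound ⟨⟨f, hfe⟩, hf⟩
          simp only [this])
  have hg : ∀ x, x ≠ Quot.mk _ u → g (π x) = x := by
    rintro ⟨w⟩ hw
    exact if_neg hw
  have huv : π (Quot.mk _ u) = π (Quot.mk _ v) := Quot.sound ⟨e, hJ⟩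
  have hbij : Function.Bijective
      fun x => if x = Quot.mk _ u then (none : Option G.Component) else some (π x) := by
    constructor
    · intro x y hxy
      by_cases hx : x = Quot.mk _ u <;> by_cases hy : y = Quot.mk _ u
      · rw [hx, hy]
      · simp [hx, hy] at hxy
      · simp [hx, hy] at hxy
      · simp only [hx, hy, if_false, Option.some.injEq] at hxy
        rw [← hg x hx, ← hg y hy, hxy]
    · rintro (_ | ⟨⟨w⟩⟩)
      · exact ⟨Quot.mk _ u, if_pos rfl⟩
      · by_cases hw : (Quot.mk _ w : (G.delete e).Component) = Quot.mk _ u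
        · refine ⟨Quot.mk _ v, ?_⟩
          have : π (Quot.mk _ w) = π (Quot.mk _ v) := by rw [hw, huv]
          simp only [if_neg h.symm]
          exact congrArg some this.symm
        · exact ⟨Quot.mk _ w, if_neg hw⟩
  unfold IsBridge numComponents
  rw [Nat.card_eq_of_bijective _ hbij, Finite.card_option]

/-! ### Potentials -/

/-- The coboundary of an integer potential `p` at the selected orientation of `e`. -/
def coboundary (p : V → ℤ) (e : E) : ℤ :=
  (G.ends e 0).elim 0 p - G.sign e * (G.ends e 1).elim 0 p

theorem sum_mul_column [Fintype V] (p : V → ℤ) (e : E) :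
    ∑ v, p v * G.column e v = G.coboundary p e := by
  simp only [column_eq, mul_sub, Finset.sum_sub_distrib, mul_left_comm (p _), ← Finset.mul_sum,
    sum_mul_attached, coboundary]

theorem finsum_coboundary_smul [Finite V] [Finite E] {A : Type*} [AddCommGroup A] (p : V → ℤ)
    (f : E → A) : ∑ᶠ e, G.coboundary p e • f e = ∑ᶠ v, p v • colSum G.column f v := by
  cases nonempty_fintype V
  cases nonempty_fintype E
  simp only [colSum, finsum_eq_sum_of_fintype, ← sum_mul_column, Finset.sum_smul, Finset.smul_sum,
    mul_smul]
  exact Finset.sum_comm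

/-- Summation by parts makes a flow orthogonal to every coboundary; here a single term of the
pairing survives. -/
theorem coboundary_smul_eq_zero [Finite V] [Finite E] {A : Type*} [AddCommGroup A] (p : V → ℤ)
    (e : E) (hp : ∀ f, f ≠ e → G.coboundary p f = 0) (f : E → A)
    (hf : ∀ v, colSum G.column f v = 0) : G.coboundary p e • f e = 0 := by
  have h := G.finsum_coboundary_smul p f
  rw [finsum_eq_single _ e fun i hi => by rw [hp i hi, zero_smul]] at h
  simpa [hf] using h

theorem ends_cases (e : E) : (∃ u v, G.ends e 0 = some u ∧ G.ends e 1 = some v) ∨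
    ∃ v, (G.ends e 0 = some v ∧ G.ends e 1 = none) ∨ (G.ends e 0 = none ∧ G.ends e 1 = some v) := by
  obtain ⟨i, hi⟩ := G.exists_end e
  rcases h0 : G.ends e 0 with _ | u <;> rcases h1 : G.ends e 1 with _ | v
  · fin_cases i <;> simp_all
  all_goals simp

theorem switch_sign {e : E} {u v : V} (ν : V → ℤˣ) (h : G.Joins e u v) :
    (G.switch ν).sign e = G.sign e * (ν u * ν v) := by
  rcases h with ⟨h0, h1⟩ | ⟨h0, h1⟩ <;> simp [switch, Fin.prod_univ_two, h0, h1, mul_comm (ν u)]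

open Classical in
/-- The potential with value `ν` on `X` and `0` elsewhere. -/
noncomputable def cutPotential (X : Set V) (ν : V → ℤˣ) (v : V) : ℤ := if v ∈ X then ν v else 0

theorem cutPotential_of_mem {X : Set V} (ν : V → ℤˣ) {v : V} (h : v ∈ X) :
    cutPotential X ν v = ν v := if_pos h

theorem cutPotential_of_notMem {X : Set V} (ν : V → ℤˣ) {v : V} (h : v ∉ X) :
    cutPotential X ν v = 0 := if_neg h

/-- An edge off the cut set either has no end in `X`, or lies inside `X` and is positive after
switching, and then its two contributions cancel. -/
theorem coboundary_cutPotential (X : Set V) (ν : V → ℤˣ) (e : E) (he : e ∉ G.cutSet X ν) :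
    G.coboundary (cutPotential X ν) e = 0 := by
  have hb : e ∉ G.between X := fun h => he (Or.inl (Or.inl h))
  have hi : e ∈ G.inner X → (G.switch ν).sign e ≠ -1 := fun h h' => he (Or.inl (Or.inr ⟨h, h'⟩))
  have ho : e ∉ G.outer X := fun h => he (Or.inr h)
  unfold coboundary
  rcases G.ends_cases e with ⟨u, v, h0, h1⟩ | ⟨v, ⟨h0, h1⟩ | ⟨h0, h1⟩⟩
  · have hJ : G.Joins e u v := Or.inl ⟨h0, h1⟩
    rw [h0, h1]
    by_cases hu : u ∈ X <;> by_cases hv : v ∈ X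
    · have h := (Int.units_eq_one_or _).resolve_right (hi ⟨u, hu, v, hv, hJ⟩)
      rw [G.switch_sign ν hJ] at h
      have h' : ν u = G.sign e * ν v := by
        have hunits : ∀ a b c : ℤˣ, a * (b * c) = 1 → b = a * c := by decide
        exact hunits _ _ _ h
      simp [cutPotential_of_mem, hu, hv, h']
    · exact absurd ⟨u, hu, v, hv, hJ⟩ hb
    · exact absurd ⟨v, hv, u, hu, hJ.symm⟩ hb
    · simp [cutPotential_of_notMem, hu, hv]
  · have hv : v ∉ X := fun hv => ho ⟨⟨1, h1⟩, v, hv, 0, h0⟩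
    simp [h0, h1, cutPotential_of_notMem, hv]
  · have hv : v ∉ X := fun hv => ho ⟨⟨0, h0⟩, v, hv, 1, h1⟩
    simp [h0, h1, cutPotential_of_notMem, hv]

open Fin.NatCast in
/-- No circle goes through a bridge. -/
theorem not_isBridge_of_not_isBalancedOn_insert (e : E) (S : Set E) (hS : G.IsBalancedOn S)
    (he : ¬ G.IsOuterEdge e) (hins : ¬ G.IsBalancedOn (insert e S)) : ¬ G.IsBridge e := by
  intro hb
  refine hins ⟨?_, fun n C hC => ?_⟩
  · rintro f (rfl | hf)
    · exact he
    · exact hS.1 f hf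
  · by_cases hCe : ∃ i, C.edge i = e
    · exfalso
      obtain ⟨i, hi⟩ := hCe
      -- The rest of the circle leads from vertex `i + 1` back to vertex `i` without `e`; the bound
      -- `k ≤ n` keeps the edge index from wrapping round to `i`.
      have hpath : ∀ k : ℕ, k ≤ n → (Quot.mk _ (C.vertex (i + 1 + k)) : (G.delete e).Component) =
          Quot.mk _ (C.vertex (i + 1)) := by
        intro k
        induction k with
        | zero => simp
        | succ k ih =>
          intro hk
          rw [← ih (by lia)]
          have hne : C.edge (i + 1 + k) ≠ e := by
            rw [← hi]
            refine fun h => ?_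
            have h' := C.edge_injective h
            rw [add_assoc, add_eq_left] at h'
            have h2 : ((k + 1 : ℕ) : Fin (n + 1)) = 0 := by
              push_cast
              rw [add_comm (k : Fin (n + 1)), h']
            rw [Fin.natCast_eq_zero] at h2
            have := Nat.le_of_dvd (by lia) h2
            lia
          refine Eq.symm (Quot.sound ⟨⟨_, hne⟩, ?_⟩)
          have := C.joins (i + 1 + k)
          push_cast
          rwa [← add_assoc]
      have hn := hpath n le_rfl
      have hni : i + 1 + (n : Fin (n + 1)) = i := by
        rw [add_assoc, add_eq_left]
        have : ((n + 1 : ℕ) : Fin (n + 1)) = 0 := by simp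
        rw [add_comm (1 : Fin (n + 1))]
        exact_mod_cast this
      rw [hni] at hn
      have hJ := C.joins i
      rw [hi] at hJ
      have := G.numComponents_delete_eq e fun u v huv => by
        rcases hJ.eq_or huv with ⟨rfl, rfl⟩ | ⟨rfl, rfl⟩
        · exact hn
        · exact hn.symm
      unfold IsBridge at hb
      lia
    · push Not at hCe
      exact hS.2 n C fun i => (hC i).resolve_left (hCe i)

/-- The potential of the cut takes coboundary `±1` on a link leaving `X` or an outer-edge. An edge
inside `X` would give `±2`, but the unbalance clause of a cut puts it on a circle, so it is neither
a bridge nor an outer-edge. -/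
theorem exists_coboundary_of_isCoLoop (e : E) (hc : G.IsCoLoop e)
    (h : G.IsBridge e ∨ G.IsOuterEdge e) :
    ∃ p : V → ℤ, (∀ f, f ≠ e → G.coboundary p f = 0) ∧ IsUnit (G.coboundary p e) := by
  obtain ⟨-, X, ν, -, -, hU, hbal, -, -, hmax⟩ := hc.1
  refine ⟨cutPotential X ν, fun f hf => G.coboundary_cutPotential X ν f ?_, ?_⟩
  · rw [← hU]
    exact hf
  have he : e ∈ G.cutSet X ν := hU ▸ Set.mem_singleton e
  unfold coboundary
  rcases he with (⟨u, hu, v, hv, hJ⟩ | ⟨hi, -⟩) | ⟨ho, v, hv, hev⟩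
  · rcases hJ with ⟨h0, h1⟩ | ⟨h0, h1⟩ <;>
      simp [h0, h1, cutPotential_of_mem, cutPotential_of_notMem, hu, show v ∉ X from hv]
  · exfalso
    obtain ⟨u, -, v, -, hJ⟩ := id hi
    exact G.not_isBridge_of_not_isBalancedOn_insert e _ hbal hJ.not_isOuterEdge (hmax e ⟨hi, rfl⟩)
      (h.resolve_right hJ.not_isOuterEdge)
  · obtain ⟨i, hi⟩ := ho
    obtain ⟨j, hj⟩ := hev
    fin_cases i <;> fin_cases j <;> simp_all [cutPotential_of_mem]

/-- A potential whose coboundary is supported on `e` with value one cuts off `e`. -/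
theorem isCoLoop_of_coboundary [Finite V] (e : E) (p : V → ℤ)
    (h : ∀ f, f ≠ e → G.coboundary p f = 0) (he : G.coboundary p e = 1) :
    G.IsCoLoop e ∧ (G.IsBridge e ∨ G.IsOuterEdge e) := by
  classical
  -- `|p|` is constant along every edge but `e`, an unattached end counting as 0.
  have habs : ∀ f ≠ e, |(G.ends f 0).elim 0 p| = |(G.ends f 1).elim 0 p| := by
    intro f hf
    rw [sub_eq_zero.1 (h f hf), abs_mul, Int.isUnit_iff_abs_eq.1 (G.sign f).isUnit, one_mul]
  have hout : ∀ f ≠ e, ∀ v, G.IsOuterEdge f → G.IsEndpoint f v → p v = 0 := by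
    rintro f hf v ⟨i, hi⟩ ⟨j, hj⟩
    have hfa := habs f hf
    rw [← abs_eq_zero]
    fin_cases i <;> fin_cases j <;> simp only [Fin.zero_eta, Fin.mk_one] at hi hj
    · simp [hi] at hj
    · simpa [hi, hj] using hfa.symm
    · simpa [hi, hj] using hfa
    · simp [hi] at hj
  have hsign : ∀ z : ℤ, z ≠ 0 → ∃ s : ℤˣ, z = s * |z| := by
    intro z hz
    rcases abs_choice z with hz' | hz'
    · exact ⟨1, by simp [hz']⟩
    · exact ⟨-1, by simp [hz']⟩
  -- Coboundary 1 gives the two end values opposite parity. A value 2 would not do, as a negative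
  -- loop shows.
  have hne : |(G.ends e 0).elim 0 p| ≠ |(G.ends e 1).elim 0 p| := by
    unfold coboundary at he
    rcases Int.units_eq_one_or (G.sign e) with hs | hs <;> rw [hs] at he <;> push_cast at he <;>
      grind
  -- The level set `|p| = k` contains exactly one end of `e`. Since `k > 0`, the sign of `p` serves
  -- as the switching on it.
  set k := max |(G.ends e 0).elim 0 p| |(G.ends e 1).elim 0 p| with hk
  have hkpos : 0 < k := by
    have := abs_nonneg ((G.ends e 0).elim 0 p)
    have := abs_nonneg ((G.ends e 1).elim 0 p)
    grind
  let X : Set V := {v | |p v| = k}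
  have hchoice : ∀ v, ∃ s : ℤˣ, (v ∈ X → p v = s * k) ∧ (v ∉ X → s = 1) := by
    intro v
    by_cases hv : v ∈ X
    · have hv' : |p v| = k := hv
      obtain ⟨s, hs⟩ := hsign (p v) (by rintro h0; rw [h0] at hv'; simp at hv'; lia)
      rw [hv'] at hs
      exact ⟨s, fun _ => hs, fun h => absurd hv h⟩
    · exact ⟨1, fun h => absurd h hv, fun _ => rfl⟩
  choose ν hν hν1 using hchoice
  have hinner : ∀ f ≠ e, f ∈ G.inner X → (G.switch ν).sign f = 1 := by
    rintro f hf ⟨u, hu, v, hv, hJ⟩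
    rw [G.switch_sign ν hJ]
    have hc := h f hf
    unfold coboundary at hc
    have hk0 : k ≠ 0 := hkpos.ne'
    have hunits : ∀ a b c : ℤˣ, (b : ℤ) - a * c = 0 → a * (b * c) = 1 := by decide
    rcases hJ with ⟨h0, h1⟩ | ⟨h0, h1⟩
    · rw [h0, h1, Option.elim_some, Option.elim_some, hν u hu, hν v hv, ← mul_assoc,
        ← sub_mul] at hc
      exact hunits _ _ _ ((mul_eq_zero_iff_right hk0).1 hc)
    · rw [h0, h1, Option.elim_some, Option.elim_some, hν u hu, hν v hv, ← mul_assoc,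
        ← sub_mul] at hc
      rw [mul_comm (ν u)]
      exact hunits _ _ _ ((mul_eq_zero_iff_right hk0).1 hc)
  have houter : e ∈ G.between X ∪ G.outer X ∧ e ∉ G.inner X := by
    rcases G.ends_cases e with ⟨u, v, h0, h1⟩ | ⟨v, hv⟩
    · have hJ : G.Joins e u v := Or.inl ⟨h0, h1⟩
      rw [h0, h1, Option.elim_some, Option.elim_some] at hne hk
      have hnot : ¬ (u ∈ X ∧ v ∈ X) := fun ⟨hu, hv⟩ => hne (Eq.trans hu (Eq.symm hv))
      refine ⟨Or.inl ?_, ?_⟩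
      · rcases max_choice |p u| |p v| with hm | hm
        · have hu : u ∈ X := (hk.trans hm).symm
          exact ⟨u, hu, v, fun hv => hnot ⟨hu, hv⟩, hJ⟩
        · have hv : v ∈ X := (hk.trans hm).symm
          exact ⟨v, hv, u, fun hu => hnot ⟨hu, hv⟩, hJ.symm⟩
      · rintro ⟨a, ha, b, hb, hab⟩
        rcases hJ.eq_or hab with ⟨rfl, rfl⟩ | ⟨rfl, rfl⟩
        · exact hnot ⟨ha, hb⟩
        · exact hnot ⟨hb, ha⟩
    · have ho : G.IsOuterEdge e ∧ G.IsEndpoint e v := by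
        rcases hv with ⟨h0, h1⟩ | ⟨h0, h1⟩
        · exact ⟨⟨1, h1⟩, 0, h0⟩
        · exact ⟨⟨0, h0⟩, 1, h1⟩
      have hvX : v ∈ X := by
        change |p v| = k
        rcases hv with ⟨h0, h1⟩ | ⟨h0, h1⟩ <;> simp [hk, h0, h1]
      exact ⟨Or.inr ⟨ho.1, v, hvX, ho.2⟩, fun ⟨a, _, b, _, hab⟩ => hab.not_isOuterEdge ho.1⟩
  have hU : {e} = G.cutSet X ν := by
    ext f
    constructor
    · rintro rfl
      exact houter.1.elim (fun h => Or.inl (Or.inl h)) Or.inr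
    · rintro ((⟨u, hu, v, hv, hJ⟩ | ⟨hi, hs⟩) | ⟨ho, v, hv, hfv⟩) <;> by_contra hf
      · have hfa := habs f hf
        refine hv (Eq.trans ?_ hu)
        rcases hJ with ⟨h0, h1⟩ | ⟨h0, h1⟩ <;> simp only [h0, h1, Option.elim_some] at hfa
        · exact hfa.symm
        · exact hfa
      · rw [hinner f hf hi] at hs
        exact absurd hs (by decide)
      · have hv' : |p v| = k := hv
        rw [hout f hf v ho hfv, abs_zero] at hv'
        exact hkpos.ne hv'
  -- This makes the clauses of `IsCut` on inner edges of the cut vacuous.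
  have hempty : ∀ f, f ∉ G.inner X ∩ {e} := fun f ⟨hf, hfe⟩ => houter.2 (hfe ▸ hf)
  have hX : X.Nonempty := by
    rcases houter.1 with ⟨v, hv, -⟩ | ⟨-, v, hv, -⟩ <;> exact ⟨v, hv⟩
  have hbal : G.IsBalancedOn (G.inner X \ {e}) := by
    refine ⟨fun f ⟨⟨a, _, b, _, hab⟩, _⟩ => hab.not_isOuterEdge, fun n C hC => ?_⟩
    have hunits : ∀ a b c : ℤˣ, a * (b * c) = 1 → a = b * c := by decide
    have hCs : ∀ i, G.sign (C.edge i) = ν (C.vertex i) * ν (C.vertex (i + 1)) := by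
      intro i
      have := hinner _ (hC i).2 (hC i).1
      rw [G.switch_sign ν (C.joins i)] at this
      exact hunits _ _ _ this
    -- Each vertex of the circle contributes `ν` twice, so the sign is 1.
    have hrot : ∏ i, ν (C.vertex (i + 1)) = ∏ i, ν (C.vertex i) :=
      Equiv.prod_comp (Equiv.addRight (1 : Fin (n + 1))) fun i => ν (C.vertex i)
    rw [Circle.sign, Finset.prod_congr rfl fun i _ => hCs i, Finset.prod_mul_distrib, hrot,
      Int.units_mul_self]
  refine ⟨⟨⟨Set.singleton_nonempty e, X, ν, hX, hν1, hU, hbal,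
    fun f hf => absurd hf (hempty f), fun f hf => hinner f hf.2 hf.1,
    fun f hf => absurd hf (hempty f)⟩, ?_⟩, ?_⟩
  · intro U hcut hle
    exact ((Set.subset_singleton_iff_eq.1 hle).resolve_left hcut.1.ne_empty).ge
  · rcases G.ends_cases e with ⟨u, v, h0, h1⟩ | ⟨v, ⟨h0, h1⟩ | ⟨h0, h1⟩⟩
    -- `|p|` is constant on components of `G.delete e` and differs at the ends of `e`.
    · refine Or.inl (G.isBridge_of_joins e (Or.inl ⟨h0, h1⟩) fun huv => hne ?_)
      have := congrArg (Quot.lift (fun v => |p v|) (by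
        rintro a b ⟨f, hf⟩
        have hfa := habs f f.2
        rcases hf with ⟨ha, hb⟩ | ⟨ha, hb⟩ <;> simp only [delete] at ha hb <;>
          simp only [ha, hb, Option.elim_some] at hfa
        · exact hfa
        · exact hfa.symm)) huv
      rw [h0, h1]
      exact this
    · exact Or.inr ⟨1, h1⟩
    · exact Or.inr ⟨0, h0⟩

/-! ### Flows separating an edge -/

/-- Characters into ℚ/ℤ detect nonzero elements, and the image of a finitely generated group in this
torsion group is finite. The product of one such image per element works. -/
theorem exists_finite_hom_ne_zero {M ι : Type*} [AddCommGroup M] [AddGroup.FG M] [Finite ι]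
    (x : ι → M) (hx : ∀ i, x i ≠ 0) :
    ∃ (A : Type) (_ : AddCommGroup A) (_ : Finite A) (φ : M →+ A), ∀ i, φ (x i) ≠ 0 := by
  choose χ hχ using fun i => CharacterModule.exists_character_apply_ne_zero_of_ne_zero (hx i)
  have htors : ∀ a : AddCircle (1 : ℚ), IsOfFinAddOrder a := by
    intro a
    obtain ⟨q, rfl⟩ := QuotientAddGroup.mk_surjective a
    refine isOfFinAddOrder_iff_nsmul_eq_zero.2 ⟨q.den, q.den_pos, ?_⟩
    rw [← QuotientAddGroup.mk_nsmul, QuotientAddGroup.eq_zero_iff]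
    refine ⟨q.num, ?_⟩
    simp [Rat.den_mul_eq_num]
  have hfin : ∀ i, Finite (χ i : M →+ AddCircle (1 : ℚ)).range := by
    intro i
    have hfg : AddGroup.FG (χ i : M →+ AddCircle (1 : ℚ)).range := AddGroup.fg_range _
    refine AddCommGroup.finite_of_fg_isAddTorsion _ fun a => ?_
    exact (AddSubgroup.subtype_injective _).isOfFinAddOrder_iff.1 (htors a)
  -- Reindexing by `Fin` keeps the product in `Type`.
  let σ := (Finite.equivFin ι).symm
  refine ⟨∀ j, (χ (σ j) : M →+ AddCircle (1 : ℚ)).range, inferInstance, inferInstance,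
    AddMonoidHom.pi fun j => AddMonoidHom.rangeRestrict _, fun i h => hχ i ?_⟩
  obtain ⟨j, rfl⟩ := σ.surjective i
  exact congrArg Subtype.val (congrFun h j)

theorem coboundary_add (p q : V → ℤ) (e : E) :
    G.coboundary (p + q) e = G.coboundary p e + G.coboundary q e := by
  unfold coboundary
  cases G.ends e 0 <;> cases G.ends e 1 <;> simp <;> ring

/-- In the cokernel of `δ`, the classes of the edge vectors form a flow. If none of them is zero, a
finite quotient in which all survive has a nowhere-zero flow, so the polynomial is not zero. -/
theorem exists_coboundary_of_flowPolynomial_eq_zero [Finite V] [Finite E]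
    (h : G.flowPolynomial = 0) :
    ∃ (e : E) (p : V → ℤ), (∀ f, f ≠ e → G.coboundary p f = 0) ∧ G.coboundary p e = 1 := by
  classical
  cases nonempty_fintype V
  cases nonempty_fintype E
  by_contra! hno
  let δ : (V → ℤ) →+ (E → ℤ) :=
    AddMonoidHom.mk' G.coboundary fun p q => funext fun e => G.coboundary_add p q e
  let π := QuotientAddGroup.mk' δ.range
  obtain ⟨A, _, _, φ, hφ⟩ := exists_finite_hom_ne_zero (fun e : E => π (Pi.single e 1)) (by
    intro e he
    obtain ⟨p, hp⟩ := (QuotientAddGroup.eq_zero_iff _).1 he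
    refine hno e p (fun f hf => ?_) ?_
    · exact (congrFun hp f).trans (Pi.single_eq_of_ne hf _)
    · exact (congrFun hp e).trans (Pi.single_eq_same _ _))
  have hmem : (fun e => φ (π (Pi.single e 1))) ∈ nzRelations A G.column := by
    refine ⟨fun v => ?_, hφ⟩
    -- Row `v` of the incidence matrix is the coboundary of the indicator of `v`, hence dies in the
    -- cokernel.
    have hsum : ∑ e, G.column e v • (Pi.single e 1 : E → ℤ) = δ (Pi.single v 1) := by
      ext e
      change _ = G.coboundary (Pi.single v 1) e
      rw [← sum_mul_column, Finset.sum_apply]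
      simp [Pi.single_apply]
    have hzero : π (δ (Pi.single v 1)) = 0 :=
      (QuotientAddGroup.eq_zero_iff _).2 ⟨_, rfl⟩
    rw [colSum, finsum_eq_sum_of_fintype]
    simp only [← map_zsmul, ← map_sum]
    rw [hsum, hzero, map_zero]
  have hcard := G.card_nzRelations_column A
  rw [h, map_zero, Nat.cast_eq_zero] at hcard
  have : Nonempty (nzRelations A G.column) := ⟨⟨_, hmem⟩⟩
  exact Nat.card_pos.ne' hcard

theorem flowPolynomial_eq_zero_of_coboundary [Finite V] [Finite E] (e : E) (p : V → ℤ)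
    (hp : ∀ f, f ≠ e → G.coboundary p f = 0) (he : IsUnit (G.coboundary p e)) :
    G.flowPolynomial = 0 := by
  refine eq_of_eval_groupPoint_eq _ _ fun A _ _ => ?_
  rw [← card_nzRelations_column, map_zero, Nat.cast_eq_zero, Nat.card_eq_zero]
  refine Or.inl ⟨fun f => f.2.2 e ?_⟩
  have := G.coboundary_smul_eq_zero p e hp f.1 f.2.1
  rcases Int.isUnit_iff.1 he with h | h <;> simpa [h] using this

theorem flowPolynomial_eq_zero_iff [Finite V] [Finite E] :
    G.flowPolynomial = 0 ↔ ∃ e : E, G.IsCoLoop e ∧ (G.IsBridge e ∨ G.IsOuterEdge e) := by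
  constructor
  · intro h
    obtain ⟨e, p, hp, he⟩ := G.exists_coboundary_of_flowPolynomial_eq_zero h
    exact ⟨e, G.isCoLoop_of_coboundary e p hp he⟩
  · rintro ⟨e, hc, h⟩
    obtain ⟨p, hp, he⟩ := G.exists_coboundary_of_isCoLoop e hc h
    exact G.flowPolynomial_eq_zero_of_coboundary e p hp he

/-- The cut potential has coboundary `±2` at `e` and 0 elsewhere, so every flow value at `e` is
2-torsion. The column of `e` has the single entry 2, so such a value contributes nothing and the
rest is a flow of `G.delete e`. -/
theorem flowPolynomial_negative_loop [Finite V] [Finite E] (e : E) (hl : G.IsLoop e)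
    (hs : G.sign e = -1) (hc : G.IsCoLoop e) :
    G.flowPolynomial = (MvPolynomial.X 0 - 1) * (G.delete e).flowPolynomial := by
  classical
  obtain ⟨u, h0, h1⟩ := hl
  obtain ⟨-, X, ν, -, -, hU, -⟩ := hc.1
  have hp : ∀ f, f ≠ e → G.coboundary (cutPotential X ν) f = 0 := fun f hf =>
    G.coboundary_cutPotential X ν f (hU ▸ hf)
  have hu : u ∈ X := by
    have hJ : G.Joins e u u := Or.inl ⟨h0, h1⟩
    have he : e ∈ G.cutSet X ν := hU ▸ Set.mem_singleton e
    rcases he with (⟨a, ha, b, -, hab⟩ | ⟨⟨a, ha, b, -, hab⟩, -⟩) | ⟨ho, -⟩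
    · rcases hJ.eq_or hab with ⟨rfl, -⟩ | ⟨rfl, -⟩ <;> exact ha
    · rcases hJ.eq_or hab with ⟨rfl, -⟩ | ⟨rfl, -⟩ <;> exact ha
    · exact absurd ho hJ.not_isOuterEdge
  have he : G.coboundary (cutPotential X ν) e = ν u * 2 := by
    simp only [coboundary, h0, h1, hs, Option.elim_some, cutPotential_of_mem ν hu]
    push_cast
    ring
  have hcol : ∀ v, G.column e v = attached (some u) v * 2 := by
    intro v
    rw [column_eq, h0, h1, hs]
    push_cast
    ring
  rw [sub_mul, one_mul, eq_sub_iff_add_eq]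
  refine G.flowPolynomial_add_delete e (G.delete e) _ fun A _ _ =>
    ⟨{a | 2 • a = 0}, fun _ => 0, ?_, fun a g => ?_⟩
  · rw [MvPolynomial.eval_X]
    rfl
  · rw [sub_zero, Set.mem_ofPred_eq]
    have hdrop : 2 • a = 0 → ∀ v, G.column e v • a = 0 := by
      intro ha v
      rw [hcol, mul_smul, ofNat_zsmul, ha, smul_zero]
    constructor
    · intro h
      have h2 : 2 • a = 0 := by
        have := G.coboundary_smul_eq_zero _ e hp (fun i => if h : i = e then a else g ⟨i, h⟩)
          fun v => by
            rw [colSum_eq_add _ e, ← h v]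
            congr 1
            · simp
            · exact congrArg (colSum _ · v) (funext fun i => dif_neg i.2)
        rw [he, mul_smul, dif_pos rfl, ofNat_zsmul] at this
        rcases Int.units_eq_one_or (ν u) with h | h <;> simpa [h] using this
      refine ⟨h2, fun v => ?_⟩
      have := h v
      rwa [hdrop h2, zero_add] at this
    · rintro ⟨h2, h⟩ v
      rw [hdrop h2, zero_add, h]

end SignedGraph

theorem mainTheorem8 {V E : Type*} [Finite V] [Finite E] (G : SignedGraph V E) :
    (∃! p : MvPolynomial (Fin 2) ℤ, G.IsFlowPolynomial p) ∧
    (∀ e : E, G.IsLoop e → G.sign e = 1 →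
      G.flowPolynomial = (MvPolynomial.X 1 - 1) * (G.delete e).flowPolynomial) ∧
    (∀ e : E, G.IsLoop e → G.sign e = -1 → G.IsCoLoop e →
      G.flowPolynomial = (MvPolynomial.X 0 - 1) * (G.delete e).flowPolynomial) ∧
    (∀ e : E, G.IsLink e → G.sign e = 1 →
      G.flowPolynomial = (G.contract e).flowPolynomial - (G.delete e).flowPolynomial) ∧
    (G.flowPolynomial = 0 ↔ ∃ e : E, G.IsCoLoop e ∧ (G.IsBridge e ∨ G.IsOuterEdge e)) :=
  ⟨⟨G.flowPolynomial, G.isFlowPolynomial_flowPolynomial,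
    fun _ hp => SignedGraph.IsFlowPolynomial.eq G hp G.isFlowPolynomial_flowPolynomial⟩,
    G.flowPolynomial_positive_loop, G.flowPolynomial_negative_loop, G.flowPolynomial_contract,
    G.flowPolynomial_eq_zero_iff⟩
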